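/- Let $A$ be a ring, $R$ a subring of $A$ with the same identity, and $x_1,\dots,x_n\in A$. For $\alpha\in\mathbb N^n$ put $x^\alpha:=x_1^{\alpha_1}\cdots x_n^{\alpha_n}$. Suppose that $A$ is a skew PBW extension of $R$ in $x_1,\dots,x_n$: the monomials $x^\alpha$ $(\alpha\in\mathbb N^n)$ form a basis of $A$ as a left $R$-module; for all $i$ and all $r\in R\setminus\{0\}$ there is $c_{i,r}\in R\setminus\{0\}$ with $x_ir-c_{i,r}x_i\in R$; and for all $i,j$ there is $d_{i,j}\in R\setminus\{0\}$ with $x_jx_i-d_{i,j}x_ix_j\in R+Rx_1+\cdots+Rx_n$. Then $x_ir=\sigma_i(r)x_i+\delta_i(r)$ for unique $\sigma_i(r),\delta_i(r)\in R$. Suppose that $A$ is bijective, i.e. each $\sigma_i:R\to R$ is bijective and $d_{i,j}$ is invertible in $R$ for all $i<j$. Fix a total order $\preceq$ on the monomials $x^\alpha$ that is degree compatible, i.e. $x^\alpha\prec x^\beta$ whenever $|\alpha|<|\beta|$, where $|\alpha|=\alpha_1+\cdots+\alpha_n$. For a right $R$-module $M_R$, let $M\langle X\rangle_A\cong M\otimes_RA$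 be the induced module: its elements are the finite formal sums $\sum_\alpha m_\alpha x^\alpha$ with $m_\alpha\in M$, and $A$ acts on the right by $(m x^\alpha)a=\sum_\beta (m c_\beta)x^\beta$ if $x^\alpha a=\sum_\beta c_\beta x^\beta$ in $A$ with $c_\beta\in R$. The leading monomial ${\rm lm}(f)$ of $f\neq 0$ is the $\preceq$-largest $x^\alpha$ with nonzero coefficient in $f$. A nonzero $f\in M\langle X\rangle_A$ is good if ${\rm lm}(fr)={\rm lm}(f)$ for every $r\in R$ with $fr\neq 0$. For a submodule $N_R$ of $M_R$, $N\langle X\rangle_A$ is the submodule of $M\langle X\rangle_A$ of the sums with all coefficients in $N$. It is called good if for every good $f\in N\langle X\rangle_A$, with ${\rm lm}(f)=x^\alpha$, and every $\beta\in\mathbb N^n$ with $\beta_i\geq\alpha_i$ for all $i$, there is a good $g\in fA$ with ${\rm lm}(g)=x^\beta$. A submodule $N$ of a right module $P_S$ is essential if $mS\cap N\neq 0$ for every $0\neq m\in P$; a module is uniform if any two nonzero submodules of it have nonzero intersection. Theorem. Let $A$ be a bijective skew PBW extension of $R$ as above, $M_R$ a right $R$-module and $N_R$ a submodule of $M_R$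 such that $N\langle X\rangle_A$ is good. Then: 1. $N_R$ is essential in $M_R$ if and only if $N\langle X\rangle_A$ is essential in $M\langle X\rangle_A$. 2. $N_R$ is uniform if and only if $N\langle X\rangle_A$ is uniform. -/

import Mathlib

open MulOpposite

namespace SkewPBW

universe u v

/-! ### Essential submodules and uniform modules

Right modules over a ring `S` are modules over `Sᵐᵒᵖ`, so that `m s` is written `op s • m`. -/

/-- `N` is essential in `P` if the cyclic submodule generated by any nonzero `m` in `P` meets `N`
nontrivially. -/
def IsEssential {S : Type u} {P : Type v} [Ring S] [AddCommGroup P] [Module S P]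
    (N : Submodule S P) : Prop :=
  ∀ m : P, m ≠ 0 → Submodule.span S {m} ⊓ N ≠ ⊥

/-- `P` is uniform if any two nonzero submodules of `P` have nonzero intersection. -/
def IsUniformModule (S : Type u) (P : Type v) [Ring S] [AddCommGroup P] [Module S P] : Prop :=
  ∀ U V : Submodule S P, U ≠ ⊥ → V ≠ ⊥ → U ⊓ V ≠ ⊥

/-! ### Skew PBW extensions -/

/-- The standard monomial `x₁ ^ α₁ * ⋯ * xₙ ^ αₙ` (factors in this order). -/
def stdMonomial {A : Type u} [Ring A] {n : ℕ} (x : Fin n → A) (α : Fin n → ℕ) : A :=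
  (List.ofFn fun i => x i ^ α i).prod

/-- `A` is a skew PBW extension of its subring `R` in the elements `x₁, …, xₙ`. -/
structure IsSkewPBWExtension {A : Type u} [Ring A] (R : Subring A) {n : ℕ} (x : Fin n → A) :
    Prop where
  /-- the standard monomials are left linearly independent over `R` -/
  linearIndependent : LinearIndependent R (stdMonomial x)
  /-- the standard monomials span `A` as a left `R`-module -/
  span_eq_top : Submodule.span R (Set.range (stdMonomial x)) = ⊤
  /-- `xᵢ r - c xᵢ ∈ R` for some `c ≠ 0` in `R` -/
  exists_coeff : ∀ (i : Fin n) (r : R), r ≠ 0 →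
    ∃ c : R, c ≠ 0 ∧ x i * (r : A) - (c : A) * x i ∈ R
  /-- `xⱼ xᵢ - d xᵢ xⱼ ∈ R + R x₁ + ⋯ + R xₙ` for some `d ≠ 0` in `R` -/
  exists_comm : ∀ i j : Fin n, ∃ d : R, d ≠ 0 ∧
    x j * x i - (d : A) * (x i * x j) ∈ Submodule.span R ({1} ∪ Set.range x)

section Extension

variable {A : Type u} [Ring A] {R : Subring A} {n : ℕ} {x : Fin n → A}

theorem stdMonomial_zero (x : Fin n → A) : stdMonomial x 0 = 1 := by
  apply List.prod_eq_one
  intro a ha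
  rw [List.mem_ofFn] at ha
  obtain ⟨i, rfl⟩ := ha
  simp

theorem stdMonomial_single : ∀ {n : ℕ} (x : Fin n → A) (i : Fin n),
    stdMonomial x (Pi.single i 1) = x i
  | 0, _, i => i.elim0
  | n + 1, x, i => by
    have h : ∀ α : Fin (n + 1) → ℕ, stdMonomial x α =
        x 0 ^ α 0 * stdMonomial (fun k => x k.succ) (fun k => α k.succ) := by
      intro α
      simp [stdMonomial, List.ofFn_succ]
    rw [h]
    refine Fin.cases ?_ (fun k => ?_) i
    · have : (fun k : Fin n => (Pi.single (0 : Fin (n + 1)) 1 : Fin (n + 1) → ℕ) k.succ) = 0 := by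
        funext k
        simp
      rw [this, stdMonomial_zero]
      simp
    · have : (fun l : Fin n => (Pi.single k.succ 1 : Fin (n + 1) → ℕ) l.succ) =
          Pi.single k 1 := by
        funext l
        simp [Pi.single_apply]
      rw [this, stdMonomial_single]
      simp

namespace IsSkewPBWExtension

/-- The basis of standard monomials of `A` as a left `R`-module. -/
noncomputable def basis (h : IsSkewPBWExtension R x) : Module.Basis (Fin n → ℕ) R A :=
  Module.Basis.mk h.linearIndependent h.span_eq_top.ge

@[simp] theorem basis_apply (h : IsSkewPBWExtension R x) (α : Fin n → ℕ) :
    h.basis α = stdMonomial x α := by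
  simp [basis]

/-- `σᵢ(r)`, the coefficient of `xᵢ` in `xᵢ r`. -/
noncomputable def sigma (h : IsSkewPBWExtension R x) (i : Fin n) (r : R) : R :=
  h.basis.repr (x i * (r : A)) (Pi.single i 1)

/-- `δᵢ(r)`, the constant coefficient of `xᵢ r`. -/
noncomputable def delta (h : IsSkewPBWExtension R x) (i : Fin n) (r : R) : R :=
  h.basis.repr (x i * (r : A)) 0

/-- The commutation rule `xᵢ r = σᵢ(r) xᵢ + δᵢ(r)`, which characterizes `σᵢ` and `δᵢ`. -/
theorem x_mul (h : IsSkewPBWExtension R x) (i : Fin n) (r : R) :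
    x i * (r : A) = (h.sigma i r : A) * x i + (h.delta i r : A) := by
  obtain ⟨c, s, hcs⟩ : ∃ c s : R, x i * (r : A) = (c : A) * x i + (s : A) := by
    by_cases hr : r = 0
    · exact ⟨0, 0, by simp [hr]⟩
    · obtain ⟨c, -, hc⟩ := h.exists_coeff i r hr
      exact ⟨c, ⟨_, hc⟩, by simp⟩
  have hb : x i * (r : A) = c • h.basis (Pi.single i 1) + s • h.basis 0 := by
    rw [hcs, h.basis_apply, h.basis_apply, stdMonomial_single, stdMonomial_zero]
    simp [Subring.smul_def]
  have hne : (Pi.single i 1 : Fin n → ℕ) ≠ 0 := by simp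
  have h1 : h.sigma i r = c := by
    simp only [sigma, hb, map_add, map_smul, Module.Basis.repr_self, Finsupp.add_apply,
      Finsupp.smul_apply, Finsupp.single_eq_same, Finsupp.single_eq_of_ne hne]
    simp
  have h2 : h.delta i r = s := by
    simp only [delta, hb, map_add, map_smul, Module.Basis.repr_self, Finsupp.add_apply,
      Finsupp.smul_apply, Finsupp.single_eq_same, Finsupp.single_eq_of_ne hne.symm]
    simp
  rw [h1, h2, hcs]

/-- The extension is bijective: every `σᵢ` is bijective and, for `i < j`, the (unique) coefficient
`d` with `xⱼ xᵢ - d xᵢ xⱼ ∈ R + R x₁ + ⋯ + R xₙ` is invertible in `R`. -/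
def IsBijective (h : IsSkewPBWExtension R x) : Prop :=
  (∀ i, Function.Bijective (h.sigma i)) ∧
  ∀ i j : Fin n, i < j → ∃ d : R, IsUnit d ∧
    x j * x i - (d : A) * (x i * x j) ∈ Submodule.span R ({1} ∪ Set.range x)

end IsSkewPBWExtension

end Extension

/-! ### The induced module -/

/-- The underlying set of the induced module: formal sums `m₁ x^α₁ + ⋯ + mₖ x^αₖ` with
coefficients in `M`, where `f α` is the coefficient of `x^α` in `f`. -/
def InducedModule {A : Type u} [Ring A] {R : Subring A} {n : ℕ} {x : Fin n → A}
    (_h : IsSkewPBWExtension R x) (M : Type v) [AddCommGroup M] : Type v :=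
  (Fin n → ℕ) →₀ M

namespace InducedModule

variable {A : Type u} [Ring A] {R : Subring A} {n : ℕ} {x : Fin n → A}
  (h : IsSkewPBWExtension R x) {M : Type v} [AddCommGroup M]

noncomputable instance : AddCommGroup (InducedModule h M) :=
  inferInstanceAs (AddCommGroup ((Fin n → ℕ) →₀ M))

/-- The coefficient of `x^α` in `f`. -/
def coeff {h : IsSkewPBWExtension R x} (f : InducedModule h M) (α : Fin n → ℕ) : M :=
  Finsupp.toFun f α

/-- The formal sum `m x^α` with a single term. -/
noncomputable def term (α : Fin n → ℕ) (m : M) : InducedModule h M :=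
  Finsupp.single α m

theorem ext_coeff {f g : InducedModule h M} (hfg : ∀ α, f.coeff α = g.coeff α) : f = g :=
  Finsupp.ext hfg

theorem coeff_add (f g : InducedModule h M) (α : Fin n → ℕ) :
    (f + g).coeff α = f.coeff α + g.coeff α := rfl

theorem coeff_term_self (α : Fin n → ℕ) (m : M) : (term h α m).coeff α = m :=
  Finsupp.single_eq_same

theorem coeff_term_of_ne {α β : Fin n → ℕ} (hβ : β ≠ α) (m : M) : (term h α m).coeff β = 0 :=
  Finsupp.single_eq_of_ne hβ

theorem hom_ext {G : Type*} [AddCommGroup G] {φ ψ : InducedModule h M →+ G}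
    (H : ∀ (α : Fin n → ℕ) (m : M), φ (term h α m) = ψ (term h α m)) : φ = ψ :=
  Finsupp.addHom_ext H

variable [Module (↥R)ᵐᵒᵖ M]

/-- For `m` in `M` and `a = ∑ c_β x^β` in `A`, the formal sum `∑ (m c_β) x^β`. -/
noncomputable def formal (m : M) : A →+ InducedModule h M :=
  (Finsupp.mapRange.addMonoidHom
    ({ toFun := fun c => op c • m
       map_zero' := by simp
       map_add' := fun a b => by simp [add_smul] } : R →+ M)).comp
  h.basis.repr.toLinearMap.toAddMonoidHom

theorem coeff_formal (m : M) (a : A) (β : Fin n → ℕ) :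
    (formal h m a).coeff β = op (h.basis.repr a β) • m := rfl

theorem formal_add (m m' : M) (a : A) : formal h (m + m') a = formal h m a + formal h m' a :=
  ext_coeff h fun β => by simp only [coeff_add, coeff_formal, smul_add]

theorem formal_zero (a : A) : formal h (0 : M) a = 0 :=
  ext_coeff h fun β => by rw [coeff_formal, smul_zero]; rfl

theorem formal_smul (m : M) (c : R) (a : A) : formal h m (c • a) = formal h (op c • m) a :=
  ext_coeff h fun β => by simp [coeff_formal, mul_smul]

theorem formal_monomial (m : M) (α : Fin n → ℕ) :
    formal h m (stdMonomial x α) = term h α m := by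
  refine ext_coeff h fun β => ?_
  rw [coeff_formal, ← h.basis_apply, Module.Basis.repr_self]
  by_cases hb : β = α
  · subst hb
    rw [coeff_term_self]
    simp
  · rw [coeff_term_of_ne h hb, Finsupp.single_eq_of_ne hb]
    simp

/-- Right multiplication by `a`, the additive map with `(m x^α) a = ∑ (m c_β) x^β` whenever
`x^α a = ∑ c_β x^β` in `A`. -/
noncomputable def act (a : A) : InducedModule h M →+ InducedModule h M :=
  Finsupp.liftAddHom (fun α : Fin n → ℕ =>
    ({ toFun := fun m => formal h m (stdMonomial x α * a)
       map_zero' := formal_zero h _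
       map_add' := fun m m' => formal_add h m m' _ } : M →+ InducedModule h M))

theorem act_term (a : A) (α : Fin n → ℕ) (m : M) :
    act h a (term h α m) = formal h m (stdMonomial x α * a) :=
  Finsupp.liftAddHom_apply_single _ _ _

theorem act_formal (m : M) (b a : A) : act h a (formal h m b) = formal h m (b * a) := by
  have hb : b ∈ Submodule.span R (Set.range (stdMonomial x)) := by
    rw [h.span_eq_top]
    trivial
  induction hb using Submodule.span_induction generalizing m with
  | mem b hb =>
    obtain ⟨α, rfl⟩ := hb
    rw [formal_monomial, act_term]
  | zero => simp
  | add b c _ _ hb hc => simp only [map_add, add_mul, hb, hc]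
  | smul c b _ hb => rw [formal_smul, hb, ← formal_smul, smul_mul_assoc]

/-- The right `A`-module structure of the induced module. -/
noncomputable instance : Module Aᵐᵒᵖ (InducedModule h M) where
  smul a f := act h a.unop f
  one_smul f := by
    have H : act h (M := M) 1 = AddMonoidHom.id _ := hom_ext h fun α m => by
      rw [act_term, mul_one, formal_monomial, AddMonoidHom.id_apply]
    exact DFunLike.congr_fun H f
  mul_smul a b f := by
    have H : act h (M := M) (b.unop * a.unop) = (act h a.unop).comp (act h b.unop) :=
      hom_ext h fun α m => by
        rw [AddMonoidHom.comp_apply, act_term, act_term, act_formal, mul_assoc]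
    exact DFunLike.congr_fun H f
  smul_zero a := map_zero (act h a.unop)
  smul_add a f g := map_add (act h a.unop) f g
  add_smul a b f := by
    have H : act h (M := M) (a.unop + b.unop) = act h a.unop + act h b.unop :=
      hom_ext h fun α m => by
        rw [AddMonoidHom.add_apply, act_term, act_term, act_term, mul_add, map_add]
    exact DFunLike.congr_fun H f
  zero_smul f := by
    have H : act h (M := M) 0 = 0 := hom_ext h fun α m => by
      rw [act_term, mul_zero, map_zero, AddMonoidHom.zero_apply]
    exact DFunLike.congr_fun H f

theorem op_smul_eq (a : A) (f : InducedModule h M) : op a • f = act h a f := rfl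

theorem act_eq_sum (a : A) (f : InducedModule h M) :
    act h a f = Finsupp.sum (f : (Fin n → ℕ) →₀ M)
      (fun α m => formal h m (stdMonomial x α * a)) := rfl

/-- For a submodule `N` of `M`, the submodule of the induced module of `M` that consists of the
formal sums with all coefficients in `N`. -/
noncomputable def ofSubmodule (N : Submodule (↥R)ᵐᵒᵖ M) : Submodule Aᵐᵒᵖ (InducedModule h M) where
  carrier := {f | ∀ α, f.coeff α ∈ N}
  zero_mem' := fun _ => N.zero_mem
  add_mem' := fun hf hg α => N.add_mem (hf α) (hg α)
  smul_mem' := by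
    intro a f hf β
    have key : ∀ (s : Finset (Fin n → ℕ)) (g : (Fin n → ℕ) → InducedModule h M),
        (∀ α ∈ s, (g α).coeff β ∈ N) → (∑ α ∈ s, g α).coeff β ∈ N := by
      intro s g hg
      have : (∑ α ∈ s, g α).coeff β = ∑ α ∈ s, (g α).coeff β :=
        map_sum (Finsupp.applyAddHom β : ((Fin n → ℕ) →₀ M) →+ M) g s
      rw [this]
      exact N.sum_mem hg
    exact key _ _ fun α _ => N.smul_mem _ (hf α)

end InducedModule

/-! ### Leading monomials and good polynomials -/

/-- A degree compatible total order on the monomials `x^α`, identified with their exponents: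
monomials of smaller total degree are smaller. -/
structure MonomialTotalOrder (n : ℕ) where
  /-- `le α β` means `x^α ⪯ x^β` -/
  le : (Fin n → ℕ) → (Fin n → ℕ) → Prop
  le_antisymm : ∀ α β, le α β → le β α → α = β
  le_trans : ∀ α β γ, le α β → le β γ → le α γ
  le_total : ∀ α β, le α β ∨ le β α
  le_of_degree_lt : ∀ α β, ∑ i, α i < ∑ i, β i → le α β

section Good

variable {A : Type u} [Ring A] {R : Subring A} {n : ℕ} {x : Fin n → A}
  {h : IsSkewPBWExtension R x} {M : Type v} [AddCommGroup M]

/-- `f` is nonzero with leading monomial `x^α`: the coefficient of `x^α` in `f` is nonzero and every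
other monomial that occurs in `f` is smaller. -/
def HasLeadingMonomial (ord : MonomialTotalOrder n) (f : InducedModule h M) (α : Fin n → ℕ) :
    Prop :=
  f.coeff α ≠ 0 ∧ ∀ β, f.coeff β ≠ 0 → ord.le β α

variable [Module (↥R)ᵐᵒᵖ M]

/-- A nonzero `f` is good if `f r` has the same leading monomial as `f` for every `r` in `R` with
`f r ≠ 0`. -/
def IsGood (ord : MonomialTotalOrder n) (f : InducedModule h M) : Prop :=
  ∃ α, HasLeadingMonomial ord f α ∧
    ∀ r : R, op (r : A) • f ≠ 0 → HasLeadingMonomial ord (op (r : A) • f) α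

/-- A submodule `B` of the induced module is good if, for every good `f` in `B` with leading
monomial `x^α` and every multiple `x^β` of `x^α` in the monoid of exponents, the submodule `f A`
contains a good element with leading monomial `x^β`. -/
def IsGoodSubmodule (ord : MonomialTotalOrder n) (B : Submodule Aᵐᵒᵖ (InducedModule h M)) : Prop :=
  ∀ f ∈ B, IsGood ord f → ∀ α, HasLeadingMonomial ord f α → ∀ β, α ≤ β →
    ∃ a : A, IsGood ord (op a • f) ∧ HasLeadingMonomial ord (op a • f) β

end Good

end SkewPBW

namespace SkewPBW

/-! ### Multiplying monomials by coefficients -/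

section Commutation

variable {A : Type*} [Ring A] {R : Subring A}

/-! Moving `r` past `x^α` gives `x^α r = s(r) x^α` plus terms of smaller degree, with `s : R → R`
surjective (`stdMonomial_mul_sub_mem_span`). So right multiplication by `R` never raises leading
monomials, and any multiple of a leading coefficient can be realized by some `r`. By
well-foundedness of the order, every nonzero `f` has a good multiple `f r`, and the annihilator in
`R` of a good element depends only on its leading monomial and leading coefficient.

Essentiality passes up by induction on the leading monomial (`exists_op_smul_mem_ofSubmodule`):
subtract from a good multiple of `f` a good element of `N⟨X⟩` with the same leading term. It passes
down by reading off a coefficient of a multiple of a constant.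

Uniformity passes up by counting. If `N` is uniform, an `R`-independent family of nonzero elements
of `N⟨X⟩` supported in a finite down-closed set `T` has at most `|T|` members
(`IsCoeffIndep.card_le`). Nonzero `U`, `V` with `U ∩ V = 0` would each contain good elements with
leading monomials `γ + μ` for all `γ` and a fixed `μ`. The bound then says that twice the number of
exponents of degree at most `d` is at most the number of degree at most `d + |μ|`, which fails for
some `d` by polynomial growth. -/

theorem stdMonomial_succ {n : ℕ} (x : Fin (n + 1) → A) (α : Fin (n + 1) → ℕ) :
    stdMonomial x α = x 0 ^ α 0 * stdMonomial (fun k => x k.succ) (fun k => α k.succ) := by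
  simp [stdMonomial, List.ofFn_succ]

/-- The map `s` is the `a`-fold iterate of `σ`, so it inherits surjectivity; only this, and no
additivity, is used later. -/
theorem pow_mul_sub_mem_span {y : A} {σ : R → R} (hσ : Function.Surjective σ)
    (hy : ∀ r : R, y * r - σ r * y ∈ R) (a : ℕ) :
    ∃ s : R → R, Function.Surjective s ∧ ∀ r : R,
      y ^ a * r - s r * y ^ a ∈ Submodule.span R ((fun b : ℕ => y ^ b) '' {b | b < a}) := by
  induction a with
  | zero => exact ⟨id, Function.surjective_id, fun r => by simp⟩
  | succ a ih =>
    obtain ⟨s, hs, hmem⟩ := ih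
    refine ⟨s ∘ σ, hs.comp hσ, fun r => ?_⟩
    have hpow : ∀ b < a + 1,
        y ^ b ∈ Submodule.span R ((fun b : ℕ => y ^ b) '' {b | b < a + 1}) :=
      fun b hb => Submodule.subset_span ⟨b, hb, rfl⟩
    have hmono : Submodule.span R ((fun b : ℕ => y ^ b) '' {b | b < a}) ≤
        Submodule.span R ((fun b : ℕ => y ^ b) '' {b | b < a + 1}) :=
      Submodule.span_mono (Set.image_mono fun b (hb : b < a) => Nat.lt_succ_of_lt hb)
    obtain ⟨c, hc⟩ : ∃ c : R, (c : A) = y * r - σ r * y := ⟨⟨_, hy r⟩, rfl⟩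
    have hright : ∀ z ∈ Submodule.span R ((fun b : ℕ => y ^ b) '' {b | b < a}),
        z * y ∈ Submodule.span R ((fun b : ℕ => y ^ b) '' {b | b < a + 1}) := by
      intro z hz
      induction hz using Submodule.span_induction with
      | mem z hz =>
        obtain ⟨b, hb, rfl⟩ := hz
        change y ^ b * y ∈ _
        rw [← pow_succ]
        exact hpow _ (Nat.succ_lt_succ hb)
      | zero => simp
      | add z w _ _ hz hw => rw [add_mul]; exact add_mem hz hw
      | smul t z _ hz => rw [smul_mul_assoc]; exact Submodule.smul_mem _ _ hz
    have key : y ^ (a + 1) * r - (s ∘ σ) r * y ^ (a + 1) =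
        (y ^ a * σ r - s (σ r) * y ^ a) * y + ((y ^ a * c - s c * y ^ a) + s c • y ^ a) := by
      rw [hc, Subring.smul_def, pow_succ, smul_eq_mul, Function.comp_apply]
      noncomm_ring
    rw [key]
    exact add_mem (hright _ (hmem _))
      (add_mem (hmono (hmem _)) (Submodule.smul_mem _ _ (hpow a (Nat.lt_succ_self a))))

/-- Moving `r` leftwards through the factors never reorders the variables, so every term that arises
is again a standard monomial with a left coefficient. -/
theorem stdMonomial_mul_sub_mem_span {n : ℕ} {x : Fin n → A} {σ : Fin n → R → R}
    (hσ : ∀ i, Function.Surjective (σ i)) (hx : ∀ i (r : R), x i * r - σ i r * x i ∈ R)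
    (α : Fin n → ℕ) :
    ∃ s : R → R, Function.Surjective s ∧ ∀ r : R,
      stdMonomial x α * r - s r * stdMonomial x α ∈
        Submodule.span R (stdMonomial x '' {γ | ∑ i, γ i < ∑ i, α i}) := by
  induction n with
  | zero => exact ⟨id, Function.surjective_id, fun r => by simp [stdMonomial]⟩
  | succ n ih =>
    obtain ⟨s, hs, hmem⟩ := ih (fun i => hσ i.succ) (fun i => hx i.succ) fun k => α k.succ
    obtain ⟨t, ht, hmem'⟩ := pow_mul_sub_mem_span (hσ 0) (hx 0) (α 0)
    refine ⟨t ∘ s, ht.comp hs, fun r => ?_⟩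
    set y : Fin n → A := fun k => x k.succ
    set β : Fin n → ℕ := fun k => α k.succ
    have hdeg : ∑ i, α i = α 0 + ∑ i, β i := Fin.sum_univ_succ α
    have hprod : ∀ (b : ℕ) (γ : Fin n → ℕ), b + ∑ i, γ i < ∑ i, α i →
        x 0 ^ b * stdMonomial y γ ∈
          Submodule.span R (stdMonomial x '' {γ | ∑ i, γ i < ∑ i, α i}) := by
      intro b γ hb
      refine Submodule.subset_span ⟨Fin.cons b γ, ?_, ?_⟩
      · simpa [Fin.sum_univ_succ] using hb
      · rw [stdMonomial_succ]
        simp [y]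
    have hlow : ∀ γ : Fin n → ℕ, ∑ i, γ i ≤ ∑ i, β i →
        ∀ z ∈ Submodule.span R ((fun b : ℕ => x 0 ^ b) '' {b | b < α 0}),
        z * stdMonomial y γ ∈
          Submodule.span R (stdMonomial x '' {γ | ∑ i, γ i < ∑ i, α i}) := by
      intro γ hγ z hz
      induction hz using Submodule.span_induction with
      | mem z hz =>
        obtain ⟨b, hb, rfl⟩ := hz
        have hb' : b < α 0 := hb
        exact hprod _ _ (by omega)
      | zero => simp
      | add z w _ _ hz hw => rw [add_mul]; exact add_mem hz hw
      | smul t z _ hz => rw [smul_mul_assoc]; exact Submodule.smul_mem _ _ hz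
    have hleft : ∀ z ∈ Submodule.span R (stdMonomial y '' {γ | ∑ i, γ i < ∑ i, β i}),
        x 0 ^ α 0 * z ∈ Submodule.span R (stdMonomial x '' {γ | ∑ i, γ i < ∑ i, α i}) := by
      intro z hz
      -- Left multiplication by a power of `x 0` is not left `R`-linear, so span induction would
      -- fail at scalars. An explicit combination lets each coefficient be moved past that power.
      rw [← Set.image_id (stdMonomial y '' _)] at hz
      obtain ⟨l, hl, rfl⟩ := (Finsupp.mem_span_image_iff_linearCombination R).1 hz
      rw [Finsupp.linearCombination_apply, Finsupp.sum, Finset.mul_sum]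
      refine sum_mem fun w hw => ?_
      obtain ⟨γ, hγ, rfl⟩ := hl hw
      have hγ' : ∑ i, γ i < ∑ i, β i := hγ
      set c : R := l (stdMonomial y γ)
      have key : x 0 ^ α 0 * (c • id (stdMonomial y γ)) =
          (x 0 ^ α 0 * c - t c * x 0 ^ α 0) * stdMonomial y γ +
            t c • (x 0 ^ α 0 * stdMonomial y γ) := by
        simp only [Subring.smul_def, smul_eq_mul, id]
        noncomm_ring
      rw [key]
      exact add_mem (hlow γ hγ'.le _ (hmem' c))
        (Submodule.smul_mem _ _ (hprod _ _ (by omega)))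
    have key : stdMonomial x α * r - (t ∘ s) r * stdMonomial x α =
        x 0 ^ α 0 * (stdMonomial y β * r - s r * stdMonomial y β) +
          (x 0 ^ α 0 * s r - t (s r) * x 0 ^ α 0) * stdMonomial y β := by
      rw [stdMonomial_succ, Function.comp_apply]
      noncomm_ring
    rw [key]
    exact add_mem (hleft _ (hmem r)) (hlow β le_rfl _ (hmem' _))

namespace IsSkewPBWExtension

variable {n : ℕ} {x : Fin n → A}

/-- The coefficient of `x^α` in `x^α r`. -/
noncomputable def monomialSigma (h : IsSkewPBWExtension R x) (α : Fin n → ℕ) (r : R) : R :=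
  h.basis.repr (stdMonomial x α * (r : A)) α

theorem exists_surjective_monomial (h : IsSkewPBWExtension R x) (hbij : h.IsBijective)
    (α : Fin n → ℕ) : ∃ s : R → R, Function.Surjective s ∧ ∀ (r : R) (γ : Fin n → ℕ),
      ¬ ∑ i, γ i < ∑ i, α i →
        h.basis.repr (stdMonomial x α * (r : A)) γ = Finsupp.single α (s r) γ := by
  obtain ⟨s, hs, hmem⟩ := stdMonomial_mul_sub_mem_span (R := R) (x := x) (σ := h.sigma)
    (fun i => (hbij.1 i).surjective) (fun i r => by rw [h.x_mul]; simp) α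
  refine ⟨s, hs, fun r γ hγ => ?_⟩
  have hr := hmem r
  rw [show stdMonomial x = h.basis from funext fun α => (h.basis_apply α).symm,
    Module.Basis.mem_span_image] at hr
  have h0 : h.basis.repr (h.basis α * (r : A) - s r * h.basis α) γ = 0 := by
    by_contra hne
    exact hγ (hr (Finsupp.mem_support_iff.2 hne))
  rw [← smul_eq_mul (s r : A), ← Subring.smul_def, map_sub, map_smul, Module.Basis.repr_self,
    Finsupp.smul_single, smul_eq_mul, mul_one, Finsupp.sub_apply, sub_eq_zero] at h0
  rw [← h.basis_apply, h0]

theorem monomialSigma_surjective (h : IsSkewPBWExtension R x) (hbij : h.IsBijective)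
    (α : Fin n → ℕ) : Function.Surjective (h.monomialSigma α) := by
  obtain ⟨s, hs, hrepr⟩ := h.exists_surjective_monomial hbij α
  convert hs
  ext r
  rw [monomialSigma, hrepr r α (lt_irrefl _), Finsupp.single_eq_same]

theorem degree_lt_of_repr_ne_zero (h : IsSkewPBWExtension R x) (hbij : h.IsBijective)
    {α γ : Fin n → ℕ} {r : R} (hne : γ ≠ α)
    (hr : h.basis.repr (stdMonomial x α * (r : A)) γ ≠ 0) : ∑ i, γ i < ∑ i, α i := by
  obtain ⟨s, -, hrepr⟩ := h.exists_surjective_monomial hbij α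
  by_contra hlt
  exact hr (by rw [hrepr r γ hlt, Finsupp.single_eq_of_ne hne])

end IsSkewPBWExtension

end Commutation

/-! ### Degree compatible orders -/

/-- The exponents of total degree at most `d`. -/
def exponentsOfDegreeLE (n d : ℕ) : Finset (Fin n → ℕ) :=
  (Fintype.piFinset fun _ => Finset.range (d + 1)).filter fun γ => ∑ i, γ i ≤ d

theorem mem_exponentsOfDegreeLE {n d : ℕ} {γ : Fin n → ℕ} :
    γ ∈ exponentsOfDegreeLE n d ↔ ∑ i, γ i ≤ d := by
  simp only [exponentsOfDegreeLE, Finset.mem_filter, Fintype.mem_piFinset, Finset.mem_range,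
    and_iff_right_iff_imp]
  intro hd i
  exact Nat.lt_succ_of_le
    ((Finset.single_le_sum (fun j _ => Nat.zero_le (γ j)) (Finset.mem_univ i)).trans hd)

theorem card_exponentsOfDegreeLE_le (n d : ℕ) : (exponentsOfDegreeLE n d).card ≤ (d + 1) ^ n :=
  (Finset.card_filter_le _ _).trans (by simp)

/-- Otherwise the count would at least double at every step of length `k`, hence grow exponentially,
against the polynomial bound `(d + 1) ^ n`. -/
theorem exists_card_exponentsOfDegreeLE_add_lt (n k : ℕ) :
    ∃ d, (exponentsOfDegreeLE n (d + k)).card < 2 * (exponentsOfDegreeLE n d).card := by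
  by_contra! hle
  have hpow : ∀ j, 2 ^ j ≤ (exponentsOfDegreeLE n (j * k)).card := by
    intro j
    induction j with
    | zero =>
      have : (0 : Fin n → ℕ) ∈ exponentsOfDegreeLE n (0 * k) := by
        simp [mem_exponentsOfDegreeLE]
      simpa using Finset.card_pos.2 ⟨_, this⟩
    | succ j ih =>
      rw [pow_succ, Nat.succ_mul]
      have := hle (j * k)
      omega
  have hlim := tendsto_pow_const_div_const_pow_of_one_lt n (r := (2 : ℝ)) (by norm_num)
  have hC : (0 : ℝ) < 1 / ((k : ℝ) + 1) ^ n := by positivity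
  obtain ⟨j, hj, hj1⟩ :=
    ((hlim.eventually (gt_mem_nhds hC)).and (Filter.eventually_ge_atTop 1)).exists
  rw [div_lt_div_iff₀ (by positivity) (by positivity), one_mul, ← mul_pow] at hj
  have h1 : (2 : ℝ) ^ j ≤ ((j * k + 1 : ℕ) : ℝ) ^ n := by
    exact_mod_cast (hpow j).trans (card_exponentsOfDegreeLE_le n (j * k))
  refine absurd hj (not_lt.2 (h1.trans ?_))
  have : j * k + 1 ≤ j * (k + 1) := by rw [mul_add, mul_one]; omega
  exact pow_le_pow_left₀ (by positivity) (by exact_mod_cast this) n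

namespace MonomialTotalOrder

variable {n : ℕ} (ord : MonomialTotalOrder n)

theorem le_refl (α : Fin n → ℕ) : ord.le α α := (ord.le_total α α).elim id id

theorem degree_le {α β : Fin n → ℕ} (hle : ord.le α β) : ∑ i, α i ≤ ∑ i, β i := by
  by_contra! hlt
  have := ord.le_antisymm _ _ hle (ord.le_of_degree_lt _ _ hlt)
  subst this
  exact lt_irrefl _ hlt

theorem exists_max {S : Finset (Fin n → ℕ)} (hS : S.Nonempty) :
    ∃ α ∈ S, ∀ β ∈ S, ord.le β α := by
  induction hS using Finset.Nonempty.cons_induction with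
  | singleton a => exact ⟨a, by simp, by simp [ord.le_refl]⟩
  | cons a s ha _ ih =>
    obtain ⟨α, hα, hmax⟩ := ih
    rcases ord.le_total a α with hle | hle
    · refine ⟨α, by simp [hα], fun β hβ => ?_⟩
      rcases Finset.mem_cons.1 hβ with rfl | hβ
      exacts [hle, hmax β hβ]
    · refine ⟨a, by simp, fun β hβ => ?_⟩
      rcases Finset.mem_cons.1 hβ with rfl | hβ
      exacts [ord.le_refl _, ord.le_trans _ _ _ (hmax β hβ) hle]

theorem wellFounded_lt : WellFounded fun α β => ord.le α β ∧ α ≠ β := by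
  classical
  let down : (Fin n → ℕ) → Finset (Fin n → ℕ) := fun α =>
    (exponentsOfDegreeLE n (∑ i, α i)).filter fun β => ord.le β α
  have hdown : ∀ α β, β ∈ down α ↔ ord.le β α := fun α β => by
    simp only [down, Finset.mem_filter, mem_exponentsOfDegreeLE, and_iff_right_iff_imp]
    exact ord.degree_le
  -- Degree compatibility leaves only finitely many exponents below a given one, and their number
  -- strictly increases along the order.
  refine Subrelation.wf (r := InvImage (· < ·) fun α => (down α).card) ?_
    (InvImage.wf _ _root_.wellFounded_lt)
  rintro α β ⟨hle, hne⟩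
  refine Finset.card_lt_card (Finset.ssubset_iff_of_subset ?_ |>.2 ⟨β, ?_, ?_⟩)
  · exact fun γ hγ => (hdown _ _).2 (ord.le_trans _ _ _ ((hdown _ _).1 hγ) hle)
  · exact (hdown _ _).2 (ord.le_refl β)
  · exact fun hβ => hne (ord.le_antisymm _ _ hle ((hdown _ _).1 hβ))

end MonomialTotalOrder

end SkewPBW

namespace SkewPBW

variable {A : Type*} [Ring A] {R : Subring A} {n : ℕ} {x : Fin n → A}
  {h : IsSkewPBWExtension R x} {M : Type*} [AddCommGroup M]

/-! ### Leading monomials of multiples by coefficients -/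

namespace InducedModule

theorem coeff_zero (α : Fin n → ℕ) : (0 : InducedModule h M).coeff α = 0 := rfl

theorem coeff_sub (f g : InducedModule h M) (α : Fin n → ℕ) :
    (f - g).coeff α = f.coeff α - g.coeff α :=
  Finsupp.sub_apply (f : (Fin n → ℕ) →₀ M) g α

theorem coeff_sum {ι : Type*} (s : Finset ι) (f : ι → InducedModule h M) (α : Fin n → ℕ) :
    (∑ i ∈ s, f i).coeff α = ∑ i ∈ s, (f i).coeff α :=
  map_sum (Finsupp.applyAddHom α : ((Fin n → ℕ) →₀ M) →+ M) f s

theorem exists_coeff_ne_zero {f : InducedModule h M} (hf : f ≠ 0) : ∃ α, f.coeff α ≠ 0 := by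
  by_contra! h0
  exact hf (ext_coeff h h0)

theorem finite_setOf_coeff_ne_zero (f : InducedModule h M) : {α | f.coeff α ≠ 0}.Finite :=
  Finsupp.hasFiniteSupport (f : (Fin n → ℕ) →₀ M)

variable [Module (↥R)ᵐᵒᵖ M]

theorem term_zero_mem_ofSubmodule {N : Submodule (↥R)ᵐᵒᵖ M} {m : M} (hm : m ∈ N) :
    term h 0 m ∈ ofSubmodule h N := fun β => by
  by_cases hβ : β = 0
  · subst hβ; rwa [coeff_term_self]
  · rw [coeff_term_of_ne h hβ]; exact N.zero_mem

theorem coeff_op_smul (a : A) (f : InducedModule h M) (γ : Fin n → ℕ) :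
    (op a • f).coeff γ = Finsupp.sum (f : (Fin n → ℕ) →₀ M)
      fun α m => op (h.basis.repr (stdMonomial x α * a) γ) • m :=
  map_sum (Finsupp.applyAddHom γ : ((Fin n → ℕ) →₀ M) →+ M) _ _

theorem exists_coeff_ne_zero_of_op_smul (hbij : h.IsBijective) {f : InducedModule h M} {r : R}
    {γ : Fin n → ℕ} (hγ : (op (r : A) • f).coeff γ ≠ 0) :
    ∃ α, f.coeff α ≠ 0 ∧ (γ = α ∨ ∑ i, γ i < ∑ i, α i) := by
  rw [coeff_op_smul] at hγ
  obtain ⟨α, hα, hne⟩ := Finset.exists_ne_zero_of_sum_ne_zero hγ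
  refine ⟨α, Finsupp.mem_support_iff.1 hα, or_iff_not_imp_left.2 fun hγα => ?_⟩
  exact h.degree_lt_of_repr_ne_zero (r := r) hbij hγα fun h0 => hne (by simp [h0])

/-- A monomial of `f` contributes only to itself and to monomials of smaller degree, and no monomial
of `f` has larger degree than `γ`. The coefficient at `γ` may be zero. -/
theorem coeff_op_smul_of_max (hbij : h.IsBijective) (ord : MonomialTotalOrder n)
    {f : InducedModule h M} {γ : Fin n → ℕ} (hmax : ∀ β, f.coeff β ≠ 0 → ord.le β γ) (r : R) :
    (op (r : A) • f).coeff γ = op (h.monomialSigma γ r) • f.coeff γ := by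
  rw [coeff_op_smul]
  refine Finsupp.sum_eq_single γ (fun β hβ hne => ?_) fun _ => smul_zero _
  have h0 : h.basis.repr (stdMonomial x β * (r : A)) γ = 0 := by
    by_contra h1
    exact absurd (h.degree_lt_of_repr_ne_zero hbij hne.symm h1)
      (not_lt.2 (ord.degree_le (hmax β hβ)))
  rw [h0, op_zero, zero_smul]

theorem le_of_op_smul (hbij : h.IsBijective) (ord : MonomialTotalOrder n)
    {f : InducedModule h M} {γ : Fin n → ℕ} (hmax : ∀ β, f.coeff β ≠ 0 → ord.le β γ) (r : R) :
    ∀ β, (op (r : A) • f).coeff β ≠ 0 → ord.le β γ := by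
  intro β hβ
  obtain ⟨α, hα, rfl | hlt⟩ := exists_coeff_ne_zero_of_op_smul hbij hβ
  · exact hmax _ hα
  · exact ord.le_trans _ _ _ (ord.le_of_degree_lt _ _ hlt) (hmax _ hα)

theorem op_smul_term_zero (m : M) (a : A) : op a • term h 0 m = formal h m a := by
  rw [op_smul_eq, act_term, stdMonomial_zero, one_mul]

theorem formal_coe (m : M) (r : R) : formal h m (r : A) = term h 0 (op r • m) := by
  rw [← formal_monomial, ← formal_smul, stdMonomial_zero, Subring.smul_def, smul_eq_mul, mul_one]

theorem op_coe_smul_smul (f : InducedModule h M) (r s : R) :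
    op (s : A) • op (r : A) • f = op ((r * s : R) : A) • f := by
  rw [smul_smul, ← op_mul, Subring.coe_mul]

end InducedModule

open InducedModule

theorem HasLeadingMonomial.ne_zero {ord : MonomialTotalOrder n} {f : InducedModule h M}
    {α : Fin n → ℕ} (hf : HasLeadingMonomial ord f α) : f ≠ 0 := by
  rintro rfl
  exact hf.1 rfl

theorem HasLeadingMonomial.unique {ord : MonomialTotalOrder n} {f : InducedModule h M}
    {α β : Fin n → ℕ} (hα : HasLeadingMonomial ord f α) (hβ : HasLeadingMonomial ord f β) :
    α = β :=
  ord.le_antisymm _ _ (hβ.2 α hα.1) (hα.2 β hβ.1)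

theorem exists_hasLeadingMonomial (ord : MonomialTotalOrder n) {f : InducedModule h M}
    (hf : f ≠ 0) : ∃ α, HasLeadingMonomial ord f α := by
  have hfin := finite_setOf_coeff_ne_zero f
  obtain ⟨α, hα, hmax⟩ := ord.exists_max (S := hfin.toFinset) <| by
    obtain ⟨α, hα⟩ := exists_coeff_ne_zero hf
    exact ⟨α, by simpa using hα⟩
  exact ⟨α, by simpa using hα, fun β hβ => hmax β (by simpa using hβ)⟩

theorem hasLeadingMonomial_term_zero (ord : MonomialTotalOrder n) {m : M} (hm : m ≠ 0) :
    HasLeadingMonomial ord (term h 0 m) 0 := by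
  refine ⟨by rwa [coeff_term_self], fun β hβ => ?_⟩
  by_cases h0 : β = 0
  · rw [h0]; exact ord.le_refl 0
  · exact absurd (coeff_term_of_ne h h0 m) hβ

theorem term_zero_ne_zero {m : M} (hm : m ≠ 0) : term h 0 m ≠ 0 := fun h0 => hm (by
  rw [← coeff_term_self h 0 m, h0, coeff_zero])

/-! ### Good elements and their annihilators in `R` -/

variable [Module (↥R)ᵐᵒᵖ M]

theorem IsGood.hasLeadingMonomial_op_smul {ord : MonomialTotalOrder n} {f : InducedModule h M}
    (hf : IsGood ord f) {α : Fin n → ℕ} (hα : HasLeadingMonomial ord f α) {r : R}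
    (hr : op (r : A) • f ≠ 0) : HasLeadingMonomial ord (op (r : A) • f) α := by
  obtain ⟨β, hβ, hgood⟩ := hf
  rw [hα.unique hβ]
  exact hgood r hr

theorem IsGood.op_smul {ord : MonomialTotalOrder n} {f : InducedModule h M}
    (hf : IsGood ord f) {r : R} (hr : op (r : A) • f ≠ 0) : IsGood ord (op (r : A) • f) := by
  obtain ⟨α, hα, hgood⟩ := hf
  refine ⟨α, hgood r hr, fun s hs => ?_⟩
  rw [op_coe_smul_smul] at hs ⊢
  exact hgood _ hs

theorem IsGood.op_smul_eq_zero_iff (hbij : h.IsBijective) {ord : MonomialTotalOrder n}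
    {f : InducedModule h M} (hf : IsGood ord f) {α : Fin n → ℕ}
    (hα : HasLeadingMonomial ord f α) (r : R) :
    op (r : A) • f = 0 ↔ op (h.monomialSigma α r) • f.coeff α = 0 := by
  rw [← coeff_op_smul_of_max hbij ord hα.2]
  refine ⟨fun h0 => by rw [h0, coeff_zero], fun h0 => ?_⟩
  by_contra hne
  exact (hf.hasLeadingMonomial_op_smul hα hne).1 h0

/-- If `f` is not good, some nonzero `f r` has a strictly smaller leading monomial, and such a
descent terminates. -/
theorem exists_isGood_op_smul (hbij : h.IsBijective) (ord : MonomialTotalOrder n)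
    {f : InducedModule h M} (hf : f ≠ 0) : ∃ r : R, IsGood ord (op (r : A) • f) := by
  obtain ⟨α, hα⟩ := exists_hasLeadingMonomial ord hf
  clear hf
  induction α using ord.wellFounded_lt.induction generalizing f with
  | _ α ih =>
    by_cases hall : ∀ r : R, op (r : A) • f ≠ 0 → HasLeadingMonomial ord (op (r : A) • f) α
    · refine ⟨1, ?_⟩
      rw [Subring.coe_one, op_one, one_smul]
      exact ⟨α, hα, hall⟩
    · push Not at hall
      obtain ⟨r, hr, hnot⟩ := hall
      obtain ⟨β, hβ⟩ := exists_hasLeadingMonomial ord hr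
      have hle := le_of_op_smul hbij ord hα.2 r β hβ.1
      obtain ⟨s, hs⟩ := ih β ⟨hle, fun hne => hnot (hne ▸ hβ)⟩ hβ
      exact ⟨r * s, by rwa [← op_coe_smul_smul]⟩

theorem isGood_term_zero (ord : MonomialTotalOrder n) {m : M} (hm : m ≠ 0) :
    IsGood ord (term h 0 m) := by
  refine ⟨0, hasLeadingMonomial_term_zero ord hm, fun r hr => ?_⟩
  rw [op_smul_term_zero, formal_coe] at hr ⊢
  refine hasLeadingMonomial_term_zero ord fun h0 => hr ?_
  rw [h0]
  exact (ext_coeff h fun β => by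
    by_cases hβ : β = 0
    · subst hβ; rw [coeff_term_self, coeff_zero]
    · rw [coeff_term_of_ne h hβ, coeff_zero])

/-! ### Essential submodules -/

theorem isEssential_iff {S P : Type*} [Ring S] [AddCommGroup P] [Module S P] {N : Submodule S P} :
    IsEssential N ↔ ∀ m : P, m ≠ 0 → ∃ s : S, s • m ≠ 0 ∧ s • m ∈ N := by
  refine forall₂_congr fun m _ => ?_
  rw [Submodule.ne_bot_iff]
  constructor
  · rintro ⟨y, ⟨hy, hyN⟩, hy0⟩
    obtain ⟨s, rfl⟩ := Submodule.mem_span_singleton.1 hy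
    exact ⟨s, hy0, hyN⟩
  · rintro ⟨s, hs, hsN⟩
    exact ⟨_, ⟨Submodule.mem_span_singleton.2 ⟨s, rfl⟩, hsN⟩, hs⟩

theorem isUniformModule_iff {S P : Type*} [Ring S] [AddCommGroup P] [Module S P] :
    IsUniformModule S P ↔
      ∀ m m' : P, m ≠ 0 → m' ≠ 0 → ∃ s t : S, s • m = t • m' ∧ s • m ≠ 0 := by
  constructor
  · intro hU m m' hm hm'
    obtain ⟨y, ⟨hy, hy'⟩, hy0⟩ := (Submodule.ne_bot_iff _).1
      (hU (Submodule.span S {m}) (Submodule.span S {m'}) (by simpa using hm) (by simpa using hm'))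
    obtain ⟨s, rfl⟩ := Submodule.mem_span_singleton.1 hy
    obtain ⟨t, ht⟩ := Submodule.mem_span_singleton.1 hy'
    exact ⟨s, t, ht.symm, hy0⟩
  · intro hP U V hU hV
    obtain ⟨u, hu, hu0⟩ := (Submodule.ne_bot_iff _).1 hU
    obtain ⟨v, hv, hv0⟩ := (Submodule.ne_bot_iff _).1 hV
    obtain ⟨s, t, hst, hne⟩ := hP u v hu0 hv0
    exact (Submodule.ne_bot_iff _).2
      ⟨s • u, ⟨U.smul_mem _ hu, hst ▸ V.smul_mem _ hv⟩, hne⟩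

theorem IsEssential.of_ofSubmodule {N : Submodule (↥R)ᵐᵒᵖ M}
    (hess : IsEssential (ofSubmodule h N)) : IsEssential N := by
  rw [isEssential_iff] at hess ⊢
  intro m hm
  obtain ⟨a, ha, haN⟩ := hess (term h 0 m) (term_zero_ne_zero hm)
  rw [← op_unop a, op_smul_term_zero] at ha haN
  obtain ⟨β, hβ⟩ := exists_coeff_ne_zero ha
  rw [coeff_formal] at hβ
  exact ⟨_, hβ, haN β⟩

/-- The multiplier is sought in `R` rather than in `A`: this keeps leading monomials from growing
and allows annihilators of good elements to be compared in the induction. -/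
theorem exists_op_smul_mem_ofSubmodule (hbij : h.IsBijective) (ord : MonomialTotalOrder n)
    {N : Submodule (↥R)ᵐᵒᵖ M} (hgood : IsGoodSubmodule ord (ofSubmodule h N))
    (hess : IsEssential N) {f : InducedModule h M} (hf : f ≠ 0) :
    ∃ r : R, op (r : A) • f ≠ 0 ∧ op (r : A) • f ∈ ofSubmodule h N := by
  rw [isEssential_iff] at hess
  obtain ⟨α, hα⟩ := exists_hasLeadingMonomial ord hf
  induction α using ord.wellFounded_lt.induction generalizing f with
  | _ α ih =>
    obtain ⟨r₀, hf₀⟩ := exists_isGood_op_smul hbij ord hf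
    obtain ⟨γ, hγ, -⟩ := id hf₀
    set f₀ := op (r₀ : A) • f with hf₀_def
    have hγα : ord.le γ α := le_of_op_smul hbij ord hα.2 r₀ γ hγ.1
    obtain ⟨c, hc, hcN⟩ := hess _ hγ.1
    obtain ⟨g, hg, hgN, hgγ⟩ : ∃ g ∈ ofSubmodule h N, IsGood ord g ∧
        HasLeadingMonomial ord g γ ∧ ∃ d : R, g.coeff γ = op d • f₀.coeff γ := by
      -- A nonzero constant is good, so goodness of `N⟨X⟩` raises its leading monomial from `1` to
      -- `x^γ`; the new leading coefficient is still a multiple of that of `f₀`.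
      have hmem := term_zero_mem_ofSubmodule (h := h) hcN
      obtain ⟨a, hga, hla⟩ := hgood _ hmem (isGood_term_zero ord hc) 0
        (hasLeadingMonomial_term_zero ord hc) γ (fun i => Nat.zero_le _)
      refine ⟨_, (ofSubmodule h N).smul_mem (op a) hmem, hga, hla,
        c.unop * h.basis.repr a γ, ?_⟩
      rw [op_smul_term_zero, coeff_formal, smul_smul, op_mul, op_unop]
    obtain ⟨hgγ, d, hd⟩ := hgγ
    -- With this `s`, the elements `f₀ s` and `g` have the same leading term, which cancels in the
    -- difference.
    obtain ⟨s, rfl⟩ := h.monomialSigma_surjective hbij γ d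
    have hs := coeff_op_smul_of_max hbij ord hγ.2 s
    have hs0 : op (s : A) • f₀ ≠ 0 := fun h0 => hgγ.1 (by rw [hd, ← hs, h0, coeff_zero])
    have hf₁ := hf₀.op_smul hs0
    have hl₁ := hf₀.hasLeadingMonomial_op_smul hγ hs0
    set f₁ := op (s : A) • f₀ with hf₁_def
    have hf₁f : f₁ = op ((r₀ * s : R) : A) • f := op_coe_smul_smul _ _ _
    by_cases hfg : f₁ - g = 0
    · refine ⟨r₀ * s, hf₁f ▸ hs0, ?_⟩
      rw [← hf₁f, sub_eq_zero.1 hfg]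
      exact hg
    · obtain ⟨β, hβ⟩ := exists_hasLeadingMonomial ord hfg
      have hβγ : ord.le β γ := by
        by_contra hnot
        have h1 : f₁.coeff β = 0 := by_contra fun h1 => hnot (hl₁.2 β h1)
        have h2 : g.coeff β = 0 := by_contra fun h1 => hnot (hgγ.2 β h1)
        exact hβ.1 (by rw [coeff_sub, h1, h2, sub_zero])
      have hne : β ≠ γ := by
        rintro rfl
        exact hβ.1 (by rw [coeff_sub, hs, hd, sub_self])
      obtain ⟨t, ht, htN⟩ := ih β ⟨ord.le_trans _ _ _ hβγ hγα, fun hβα => hne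
        (ord.le_antisymm _ _ hβγ (hβα ▸ hγα))⟩ hfg hβ
      refine ⟨r₀ * s * t, ?_, ?_⟩
      -- `f₁` and `g` are good with equal leading terms, so they have the same annihilator: `f₁ t =
      -- 0` would force `g t = 0` and hence `(f₁ - g) t = 0`.
      · rw [← op_coe_smul_smul, ← hf₁f]
        intro h0
        refine ht ?_
        rw [smul_sub, h0, zero_sub, neg_eq_zero, hgN.op_smul_eq_zero_iff hbij hgγ, hd, ← hs,
          ← hf₁.op_smul_eq_zero_iff hbij hl₁]
        exact h0
      · rw [← op_coe_smul_smul, ← hf₁f, ← sub_add_cancel f₁ g, smul_add]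
        exact add_mem htN ((ofSubmodule h N).smul_mem _ hg)

theorem IsEssential.ofSubmodule (hbij : h.IsBijective) (ord : MonomialTotalOrder n)
    {N : Submodule (↥R)ᵐᵒᵖ M} (hgood : IsGoodSubmodule ord (ofSubmodule h N))
    (hess : IsEssential N) : IsEssential (ofSubmodule h N) :=
  isEssential_iff.2 fun _ hf =>
    let ⟨r, hr⟩ := exists_op_smul_mem_ofSubmodule hbij ord hgood hess hf
    ⟨op (r : A), hr⟩

end SkewPBW

namespace SkewPBW

open InducedModule

variable {A : Type*} [Ring A] {R : Subring A} {n : ℕ} {x : Fin n → A}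
  {h : IsSkewPBWExtension R x} {M : Type*} [AddCommGroup M] [Module (↥R)ᵐᵒᵖ M]

/-! ### Families that are independent over the coefficient ring -/

/-- The sum of the `R`-submodules generated by the members of the family is direct. -/
def IsCoeffIndep {ι : Type*} [Fintype ι] (f : ι → InducedModule h M) : Prop :=
  ∀ r : ι → R, ∑ i, op (r i : A) • f i = 0 → ∀ i, op (r i : A) • f i = 0

theorem IsCoeffIndep.op_smul {ι : Type*} [Fintype ι] {f : ι → InducedModule h M}
    (hf : IsCoeffIndep f) (s : ι → R) : IsCoeffIndep fun i => op (s i : A) • f i := by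
  intro r hr
  simp only [op_coe_smul_smul] at hr ⊢
  exact hf (fun i => s i * r i) hr

/-- A relation among the differences is a relation among the `f i`, so each `f i s r` vanishes;
`hst` then kills the matching multiple of `f i₀`. -/
theorem IsCoeffIndep.op_smul_sub {ι : Type*} [Fintype ι] [DecidableEq ι]
    {f : ι → InducedModule h M} (hf : IsCoeffIndep f) (i₀ : ι) (s t : {i // i ≠ i₀} → R)
    (hst : ∀ i (r : R), op ((s i * r : R) : A) • f i = 0 → op ((t i * r : R) : A) • f i₀ = 0) :
    IsCoeffIndep fun i : {i // i ≠ i₀} => op (s i : A) • f i - op (t i : A) • f i₀ := by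
  intro r hr i
  simp only [smul_sub, op_coe_smul_smul] at hr ⊢
  let c : ι → R := fun i => if hi : i ≠ i₀ then s ⟨i, hi⟩ * r ⟨i, hi⟩ else -∑ j, t j * r j
  have hc : ∀ i : {i // i ≠ i₀}, c i = s i * r i := fun i => dif_pos i.2
  have hc₀ : c i₀ = -∑ j, t j * r j := dif_neg (by simp)
  have hsum : ∑ i, op (c i : A) • f i = 0 := by
    rw [Fintype.sum_eq_add_sum_subtype_ne _ i₀, hc₀, ← hr, Finset.sum_sub_distrib]
    simp only [hc]
    rw [Subring.coe_neg, AddSubmonoidClass.coe_finsetSum, op_neg, Finset.op_sum, neg_smul,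
      Finset.sum_smul]
    abel
  have hi := hf c hsum i
  rw [hc] at hi
  rw [hi, hst i _ hi, sub_zero]

theorem IsCoeffIndep.sum_elim {ι κ : Type*} [Fintype ι] [Fintype κ] {f : ι → InducedModule h M}
    {g : κ → InducedModule h M} (hf : IsCoeffIndep f) (hg : IsCoeffIndep g)
    {U V : Submodule Aᵐᵒᵖ (InducedModule h M)} (hUV : U ⊓ V = ⊥) (hfU : ∀ i, f i ∈ U)
    (hgV : ∀ i, g i ∈ V) : IsCoeffIndep (Sum.elim f g) := by
  intro r hr
  rw [Fintype.sum_sum_type] at hr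
  simp only [Sum.elim_inl, Sum.elim_inr] at hr
  have hU : ∑ i, op (r (Sum.inl i) : A) • f i ∈ U :=
    sum_mem fun i _ => U.smul_mem _ (hfU i)
  have hV : ∑ i, op (r (Sum.inr i) : A) • g i ∈ V :=
    sum_mem fun i _ => V.smul_mem _ (hgV i)
  have hf0 : ∑ i, op (r (Sum.inl i) : A) • f i = 0 := by
    rw [← Submodule.mem_bot Aᵐᵒᵖ, ← hUV]
    exact ⟨hU, by rw [eq_neg_of_add_eq_zero_left hr]; exact V.neg_mem hV⟩
  rw [hf0, zero_add] at hr
  rintro (i | i)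
  exacts [hf _ hf0 i, hg _ hr i]

/-- Nonzero multiples of good elements keep their distinct leading monomials, so the largest of
these cannot cancel in a sum. -/
theorem IsCoeffIndep.of_isGood {ι : Type*} [Fintype ι] (ord : MonomialTotalOrder n)
    {f : ι → InducedModule h M} {α : ι → Fin n → ℕ} (hα : Function.Injective α)
    (hf : ∀ i, IsGood ord (f i)) (hl : ∀ i, HasLeadingMonomial ord (f i) (α i)) :
    IsCoeffIndep f := by
  classical
  intro r hr
  by_contra! hne
  obtain ⟨i, hi⟩ := hne
  obtain ⟨γ, hγ, hmax⟩ := ord.exists_max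
    (S := (Finset.univ.filter fun i => op (r i : A) • f i ≠ 0).image α)
    ⟨α i, Finset.mem_image_of_mem _ (by simpa using hi)⟩
  obtain ⟨j, hj, rfl⟩ := Finset.mem_image.1 hγ
  have hj0 : op (r j : A) • f j ≠ 0 := by simpa using hj
  refine ((hf j).hasLeadingMonomial_op_smul (hl j) hj0).1 ?_
  have hsum := coeff_sum Finset.univ (fun i => op (r i : A) • f i) (α j)
  rw [hr, coeff_zero, Finset.sum_eq_single j] at hsum
  · exact hsum.symm
  · intro k _ hkj
    by_contra hk
    have hk0 : op (r k : A) • f k ≠ 0 := fun h0 => hk (by rw [h0, coeff_zero])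
    have hle := ((hf k).hasLeadingMonomial_op_smul (hl k) hk0).2 _ hk
    exact hkj (hα (ord.le_antisymm _ _ (hmax _ (Finset.mem_image_of_mem _ (by simpa using hk0)))
      hle))
  · simp

theorem mem_of_coeff_op_smul_ne_zero (hbij : h.IsBijective) (ord : MonomialTotalOrder n)
    {T : Finset (Fin n → ℕ)} (hT : ∀ γ ∈ T, ∀ β, ord.le β γ → β ∈ T) {f : InducedModule h M}
    (hf : ∀ β, f.coeff β ≠ 0 → β ∈ T) (r : R) :
    ∀ β, (op (r : A) • f).coeff β ≠ 0 → β ∈ T := by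
  intro β hβ
  obtain ⟨α, hα, rfl | hlt⟩ := exists_coeff_ne_zero_of_op_smul hbij hβ
  · exact hf _ hα
  · exact hT _ (hf _ hα) _ (ord.le_of_degree_lt _ _ hlt)

theorem exists_coeff_op_smul_sub_eq_zero (hbij : h.IsBijective) (ord : MonomialTotalOrder n)
    {N : Submodule (↥R)ᵐᵒᵖ M} (hN : IsUniformModule (↥R)ᵐᵒᵖ N) {f g : InducedModule h M}
    {τ : Fin n → ℕ} (hfN : f ∈ ofSubmodule h N) (hgN : g ∈ ofSubmodule h N)
    (hf : HasLeadingMonomial ord f τ) (hg : HasLeadingMonomial ord g τ) :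
    ∃ s t : R, (op (s : A) • f).coeff τ ≠ 0 ∧
      (op (s : A) • f - op (t : A) • g).coeff τ = 0 := by
  obtain ⟨c, d, hcd, hne⟩ := isUniformModule_iff.1 hN ⟨_, hfN τ⟩ ⟨_, hgN τ⟩
    (fun h0 => hf.1 (congrArg Subtype.val h0)) (fun h0 => hg.1 (congrArg Subtype.val h0))
  obtain ⟨s, hs⟩ := h.monomialSigma_surjective hbij τ c.unop
  obtain ⟨t, ht⟩ := h.monomialSigma_surjective hbij τ d.unop
  have hcd' : c • f.coeff τ = d • g.coeff τ := congrArg Subtype.val hcd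
  refine ⟨s, t, ?_, ?_⟩
  · rw [coeff_op_smul_of_max hbij ord hf.2, hs, op_unop]
    exact fun h0 => hne (Subtype.ext h0)
  · rw [coeff_sub, coeff_op_smul_of_max hbij ord hf.2, coeff_op_smul_of_max hbij ord hg.2, hs, ht,
      op_unop, op_unop, hcd', sub_self]

/-- Gaussian elimination at the largest exponent `τ` of `T`, with uniformity of `N` in place of
division: each pass removes `τ` from the supports at the cost of at most one member. -/
theorem IsCoeffIndep.card_le (hbij : h.IsBijective) (ord : MonomialTotalOrder n)
    {N : Submodule (↥R)ᵐᵒᵖ M} (hN : IsUniformModule (↥R)ᵐᵒᵖ N) {T : Finset (Fin n → ℕ)}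
    (hT : ∀ γ ∈ T, ∀ β, ord.le β γ → β ∈ T) {ι : Type} [Fintype ι] {f : ι → InducedModule h M}
    (hfN : ∀ i, f i ∈ ofSubmodule h N) (hf0 : ∀ i, f i ≠ 0)
    (hfT : ∀ i β, (f i).coeff β ≠ 0 → β ∈ T) (hf : IsCoeffIndep f) :
    Fintype.card ι ≤ T.card := by
  classical
  induction hk : T.card generalizing T ι with
  | zero =>
    rw [Finset.card_eq_zero] at hk
    subst hk
    rw [Nat.le_zero, Fintype.card_eq_zero_iff]
    refine ⟨fun i => ?_⟩
    obtain ⟨β, hβ⟩ := exists_coeff_ne_zero (hf0 i)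
    exact absurd (hfT i β hβ) (Finset.notMem_empty β)
  | succ k ih =>
    obtain ⟨τ, hτ, hmax⟩ := ord.exists_max (Finset.card_pos.1 (show 0 < T.card by omega))
    have hcard : (T.erase τ).card = k := by rw [Finset.card_erase_of_mem hτ, hk]; rfl
    have hdown : ∀ γ ∈ T.erase τ, ∀ β, ord.le β γ → β ∈ T.erase τ := by
      intro γ hγ β hβ
      obtain ⟨hne, hγT⟩ := Finset.mem_erase.1 hγ
      refine Finset.mem_erase.2 ⟨?_, hT _ hγT _ hβ⟩
      rintro rfl
      exact hne (ord.le_antisymm _ _ (hmax _ hγT) hβ)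
    have herase : ∀ g : InducedModule h M, (∀ β, g.coeff β ≠ 0 → β ∈ T) → g.coeff τ = 0 →
        ∀ β, g.coeff β ≠ 0 → β ∈ T.erase τ := fun g hg h0 β hβ =>
      Finset.mem_erase.2 ⟨fun hβτ => hβ (hβτ ▸ h0), hg β hβ⟩
    have hfrT : ∀ i (r : R) β, (op (r : A) • f i).coeff β ≠ 0 → β ∈ T := fun i =>
      mem_of_coeff_op_smul_ne_zero hbij ord hT (hfT i)
    have hfrN : ∀ i (r : R), op (r : A) • f i ∈ ofSubmodule h N := fun i r =>
      (ofSubmodule h N).smul_mem _ (hfN i)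
    by_cases hall : ∀ i, ∃ r : R, op (r : A) • f i ≠ 0 ∧ (op (r : A) • f i).coeff τ = 0
    · choose r hr hrτ using hall
      exact (ih hdown (fun i => hfrN i (r i)) hr (fun i => herase _ (hfrT i (r i)) (hrτ i))
        (hf.op_smul r) hcard).trans (Nat.le_succ k)
    -- The pivot is an `f i₀` none of whose nonzero multiples loses its coefficient at `τ`.
    · push Not at hall
      obtain ⟨i₀, hi₀⟩ := hall
      have hlead : ∀ i, (f i).coeff τ ≠ 0 → HasLeadingMonomial ord (f i) τ := fun i hi =>
        ⟨hi, fun β hβ => hmax β (hfT i β hβ)⟩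
      have hl₀ : HasLeadingMonomial ord (f i₀) τ := hlead i₀ (by
        have := hi₀ 1
        rw [Subring.coe_one, op_one, one_smul] at this
        exact this (hf0 i₀))
      have hex : ∀ i : {i // i ≠ i₀}, ∃ s t : R, op (s : A) • f i ≠ 0 ∧
          (op (s : A) • f i - op (t : A) • f i₀).coeff τ = 0 ∧
          ∀ r : R, op ((s * r : R) : A) • f i = 0 → op ((t * r : R) : A) • f i₀ = 0 := by
        intro i
        by_cases hi : (f i).coeff τ = 0
        · refine ⟨1, 0, ?_, ?_, fun r _ => ?_⟩
          · rw [Subring.coe_one, op_one, one_smul]; exact hf0 i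
          · rw [Subring.coe_one, op_one, one_smul, Subring.coe_zero, op_zero, zero_smul, sub_zero,
              hi]
          · rw [zero_mul, Subring.coe_zero, op_zero, zero_smul]
        · obtain ⟨s, t, hs, hst⟩ := exists_coeff_op_smul_sub_eq_zero hbij ord hN (hfN i) (hfN i₀)
            (hlead i hi) hl₀
          refine ⟨s, t, fun h0 => hs (by rw [h0, coeff_zero]), hst, fun r hr => ?_⟩
          by_contra hne
          refine hi₀ _ hne ?_
          have hsub : ∀ β, (op (s : A) • f i - op (t : A) • f i₀).coeff β ≠ 0 → β ∈ T.erase τ :=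
            herase _ (fun β hβ => by
              by_contra hβT
              refine hβ ?_
              rw [coeff_sub, not_not.1 (mt (hfrT i s β) hβT), not_not.1 (mt (hfrT i₀ t β) hβT),
                sub_zero]) hst
          -- As `f i s r = 0`, the product `(f i s - f i₀ t) r` is `-(f i₀ t r)`. Its support avoids
          -- `τ` because `T.erase τ` is down-closed, so the choice of pivot makes `f i₀ t r` zero.
          have h1 := mem_of_coeff_op_smul_ne_zero hbij ord hdown hsub r τ
          rw [smul_sub, op_coe_smul_smul, op_coe_smul_smul, hr, zero_sub] at h1
          by_contra hcoeff
          refine absurd (h1 ?_) (Finset.notMem_erase τ T)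
          rw [← zero_sub, coeff_sub, coeff_zero, zero_sub]
          exact neg_ne_zero.2 hcoeff
      choose s t hs hst hann using hex
      have hle := ih hdown (f := fun i : {i // i ≠ i₀} => op (s i : A) • f i - op (t i : A) • f i₀)
        (fun i => sub_mem (hfrN _ _) (hfrN _ _)) ?_ ?_ (hf.op_smul_sub i₀ s t hann) hcard
      · rw [Fintype.card_subtype_compl, Fintype.card_subtype_eq] at hle
        omega
      · intro i h0
        -- A vanishing difference would be a relation between `f i` and `f i₀`, and independence
        -- would give `f i s = 0`.
        have h1 := hf (Pi.single i.1 (s i) + Pi.single i₀ (-t i)) (by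
          rw [← h0, Fintype.sum_eq_add i.1 i₀ i.2]
          · simp [i.2, i.2.symm, sub_eq_add_neg]
          · rintro j ⟨hj, hj'⟩
            simp [hj, hj']) i
        simp only [Pi.add_apply, Pi.single_eq_same, Pi.single_eq_of_ne i.2, add_zero] at h1
        exact hs i h1
      · intro i
        refine herase _ (fun β hβ => ?_) (hst i)
        by_contra hβT
        refine hβ ?_
        rw [coeff_sub, not_not.1 (mt (hfrT i (s i) β) hβT),
          not_not.1 (mt (hfrT i₀ (t i) β) hβT), sub_zero]

/-! ### Uniform modules -/

theorem isUniformModule_ofSubmodule (hbij : h.IsBijective) (ord : MonomialTotalOrder n)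
    {N : Submodule (↥R)ᵐᵒᵖ M} (hgood : IsGoodSubmodule ord (ofSubmodule h N))
    (hN : IsUniformModule (↥R)ᵐᵒᵖ N) : IsUniformModule Aᵐᵒᵖ (ofSubmodule h N) := by
  intro U V hU hV hUV
  have hgoodElt : ∀ W : Submodule Aᵐᵒᵖ (ofSubmodule h N), W ≠ ⊥ → ∃ α : Fin n → ℕ, ∀ β, α ≤ β →
      ∃ f ∈ W.map (ofSubmodule h N).subtype, IsGood ord f ∧ HasLeadingMonomial ord f β := by
    intro W hW
    obtain ⟨w, hw, hw0⟩ := (Submodule.ne_bot_iff _).1 hW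
    obtain ⟨r, hr⟩ := exists_isGood_op_smul hbij ord (f := w.1) fun h0 => hw0 (Subtype.ext h0)
    obtain ⟨α, hα, -⟩ := id hr
    refine ⟨α, fun β hβ => ?_⟩
    obtain ⟨a, ha⟩ := hgood _ ((ofSubmodule h N).smul_mem _ w.2) hr α hα β hβ
    exact ⟨_, Submodule.smul_mem _ _ (Submodule.smul_mem _ _ (Submodule.mem_map_of_mem hw)), ha⟩
  obtain ⟨α, hα⟩ := hgoodElt U hU
  obtain ⟨β, hβ⟩ := hgoodElt V hV
  -- Shifting by `α ⊔ β` places the leading monomials in the range available to both `U` and `V`.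
  have hu : ∀ γ, ∃ f ∈ U.map (ofSubmodule h N).subtype, IsGood ord f ∧
      HasLeadingMonomial ord f (γ + α ⊔ β) := fun γ =>
    hα _ (le_sup_left.trans (le_add_of_nonneg_left zero_le))
  have hv : ∀ γ, ∃ f ∈ V.map (ofSubmodule h N).subtype, IsGood ord f ∧
      HasLeadingMonomial ord f (γ + α ⊔ β) := fun γ =>
    hβ _ (le_sup_right.trans (le_add_of_nonneg_left zero_le))
  choose u huU hu hul using hu
  choose v hvV hv hvl using hv
  obtain ⟨d, hd⟩ := exists_card_exponentsOfDegreeLE_add_lt n (∑ i, (α ⊔ β) i)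
  refine absurd hd (not_lt.2 ?_)
  have hinj : Function.Injective fun γ : exponentsOfDegreeLE n d => (γ : Fin n → ℕ) + α ⊔ β :=
    fun γ γ' hγ => Subtype.ext (add_right_cancel hγ)
  have hindep : IsCoeffIndep (Sum.elim (fun γ : exponentsOfDegreeLE n d => u γ)
      fun γ : exponentsOfDegreeLE n d => v γ) :=
    IsCoeffIndep.sum_elim (IsCoeffIndep.of_isGood ord hinj (fun γ => hu γ) fun γ => hul γ)
      (IsCoeffIndep.of_isGood ord hinj (fun γ => hv γ) fun γ => hvl γ)
      (by rw [← Submodule.map_inf _ (Submodule.injective_subtype _), hUV, Submodule.map_bot])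
      (fun γ => huU γ) fun γ => hvV γ
  have hmem : ∀ γ ∈ exponentsOfDegreeLE n d, ∀ δ, ord.le δ (γ + α ⊔ β) →
      δ ∈ exponentsOfDegreeLE n (d + ∑ i, (α ⊔ β) i) := by
    intro γ hγ δ hδ
    rw [mem_exponentsOfDegreeLE] at hγ ⊢
    have := ord.degree_le hδ
    simp only [Pi.add_apply, Finset.sum_add_distrib] at this
    omega
  have hcard := hindep.card_le hbij ord hN
    (T := exponentsOfDegreeLE n (d + ∑ i, (α ⊔ β) i)) ?_ ?_ ?_ ?_
  · rw [Fintype.card_sum, Fintype.card_coe] at hcard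
    omega
  · intro γ hγ δ hδ
    rw [mem_exponentsOfDegreeLE] at hγ ⊢
    exact (ord.degree_le hδ).trans hγ
  · rintro (γ | γ)
    exacts [Submodule.map_subtype_le _ _ (huU γ), Submodule.map_subtype_le _ _ (hvV γ)]
  · rintro (γ | γ)
    exacts [(hul γ).ne_zero, (hvl γ).ne_zero]
  · rintro (γ | γ) δ hδ
    exacts [hmem γ γ.2 δ ((hul γ).2 δ hδ), hmem γ γ.2 δ ((hvl γ).2 δ hδ)]

/-- Any coefficient of an element of `U⟨X⟩ ∩ V⟨X⟩` lies in `U ∩ V`. -/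
theorem IsUniformModule.of_ofSubmodule {N : Submodule (↥R)ᵐᵒᵖ M}
    (hN : IsUniformModule Aᵐᵒᵖ (ofSubmodule h N)) : IsUniformModule (↥R)ᵐᵒᵖ N := by
  intro U V hU hV hUV
  let ext : Submodule (↥R)ᵐᵒᵖ N → Submodule Aᵐᵒᵖ (ofSubmodule h N) := fun W =>
    (ofSubmodule h (W.map N.subtype)).comap (ofSubmodule h N).subtype
  have hext : ∀ W, W ≠ ⊥ → ext W ≠ ⊥ := by
    intro W hW
    obtain ⟨w, hw, hw0⟩ := (Submodule.ne_bot_iff _).1 hW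
    refine (Submodule.ne_bot_iff _).2 ⟨⟨_, term_zero_mem_ofSubmodule w.2⟩,
      term_zero_mem_ofSubmodule (Submodule.mem_map_of_mem hw), ?_⟩
    intro h0
    exact term_zero_ne_zero (h := h) (fun hw' => hw0 (Subtype.ext hw')) (congrArg Subtype.val h0)
  obtain ⟨f, ⟨hfU, hfV⟩, hf0⟩ := (Submodule.ne_bot_iff _).1 (hN _ _ (hext U hU) (hext V hV))
  obtain ⟨β, hβ⟩ := exists_coeff_ne_zero (f := f.1) fun h0 => hf0 (Subtype.ext h0)
  have hmem : f.1.coeff β ∈ U.map N.subtype ⊓ V.map N.subtype := ⟨hfU β, hfV β⟩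
  rw [← Submodule.map_inf _ (Submodule.injective_subtype _), hUV, Submodule.map_bot] at hmem
  exact hβ hmem

end SkewPBW

theorem theorem4p6 {A : Type*} [Ring A] {R : Subring A} {n : ℕ} {x : Fin n → A}
    (h : SkewPBW.IsSkewPBWExtension R x) (hbij : h.IsBijective)
    (ord : SkewPBW.MonomialTotalOrder n)
    {M : Type*} [AddCommGroup M] [Module (↥R)ᵐᵒᵖ M] (N : Submodule (↥R)ᵐᵒᵖ M)
    (hgood : SkewPBW.IsGoodSubmodule ord (SkewPBW.InducedModule.ofSubmodule h N)) :
    (SkewPBW.IsEssential N ↔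
      SkewPBW.IsEssential (SkewPBW.InducedModule.ofSubmodule h N)) ∧
    (SkewPBW.IsUniformModule (↥R)ᵐᵒᵖ ↥N ↔
      SkewPBW.IsUniformModule Aᵐᵒᵖ ↥(SkewPBW.InducedModule.ofSubmodule h N)) :=
  ⟨⟨fun hess => hess.ofSubmodule hbij ord hgood, fun hess => hess.of_ofSubmodule⟩,
    ⟨SkewPBW.isUniformModule_ofSubmodule hbij ord hgood, fun hN => hN.of_ofSubmodule⟩⟩
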